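/- Let $G$ be a finitely generated discrete amenable group, i.e. $G$ has a Følner sequence (nonempty finite sets $F_n\subseteq G$ with $|gF_n\bigtriangleup F_n|/|F_n|\to 0$ for all $g\in G$). Let $G$ act by homeomorphisms on a Cantor set $X$, and suppose that $(X,G)$ is regularly recurrent: $X$ is the orbit closure of a point $x$ such that for every open neighbourhood $V$ of $x$ the set $\{g\in G: g.x\in V\}$ contains a syndetic (finite index) subgroup of $G$. A *Kakutani–Rohlin sequence* for $(X,G)$ consists of finite clopen partitions $\mathcal P_n=\{w.C_{n,i}: w\in D_n,\ 1\le i\le k_n\}$ of $X$ ($n\ge 0$, the sets $w.C_{n,i}$ being nonempty and pairwise disjoint for distinct pairs $(w,i)$) such that, with $C_n=\bigcup_{i}C_{n,i}$: (1) $C_{n+1}\subseteq C_n$; (2) there is a syndetic subgroup $\Gamma_n$ of $G$ such that $D_n\subseteq G$ contains exactly one representative of each class $g\Gamma_n\in G/\Gamma_n$, and $\{g\in G: g.x\in C_n\}=\Gamma_n$ for all $x\in C_n$; (3) $\mathcal P_{n+1}$ is finer than $\mathcal P_n$; (4) the members of all the $\mathcal P_n$ form a basis of the topology of $X$. Its incidence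 matrices are $A_n(i,j)=|\{w\in D_{n+1}: w.C_{n+1,j}\subseteq C_{n,i}\}|$, its simplices are $\triangle_n=\{x\in[0,\infty)^{k_n}:\sum_i x_i=1/|D_n|\}$, and $$\lim_{\leftarrow n}(\triangle_n,A_n)=\Big\{(x_n)_n\in\prod_n\triangle_n:\ A_nx_{n+1}=x_n \text{ for all } n\Big\}$$ with the product topology and coordinatewise convex combinations. The sequence has *uniform incidence* if, for all $n,i,j$ and all $u\in D_n$, $|\{w\in D_{n+1}: w.C_{n+1,j}\subseteq u.C_{n,i}\}|=A_n(i,j)$. It is a *Følner* sequence if $(D_n)_n$ is a Følner sequence of $G$. Suppose, as a standing convention, that $(X,G)$ has a Følner Kakutani–Rohlin sequence. Then: (a) $(X,G)$ has a Følner Kakutani–Rohlin sequence with uniform incidence; (b) for every Følner Kakutani–Rohlin sequence with uniform incidence, the map $\mu\mapsto(\mu(C_{n,i}))_{n,i}$ is an affine homeomorphism of the set $\mathcal M_G(X)$ of $G$-invariant Borel probability measures on $X$ (with the weak topology) onto $\lim_{\leftarrow n}(\triangle_n,A_n)$. In particular $\mathcal M_G(X)$ is affinely homeomorphic to such an inverse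 limit. -/

import Mathlib

open MeasureTheory Filter Topology
open scoped Pointwise symmDiff

noncomputable section

/-! ### Følner sequences and amenability of a discrete group -/

/-- A sequence of nonempty finite subsets of `G` with `|g F_n ∆ F_n| / |F_n| → 0` for all `g`. -/
def IsFolnerSequence {G : Type*} [Group G] (F : ℕ → Finset G) : Prop :=
  (∀ n, (F n).Nonempty) ∧
    ∀ g : G, Tendsto
      (fun n => (Set.ncard ((g • (F n : Set G)) ∆ (F n : Set G)) : ℝ) / ((F n).card : ℝ))
      atTop (𝓝 0)

/-- Amenability of a (finitely generated) discrete group, through Følner sequences. -/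
def IsAmenableGroup (G : Type*) [Group G] : Prop :=
  ∃ F : ℕ → Finset G, IsFolnerSequence F

/-! ### Regularly recurrent Cantor systems -/

/-- A subset `S` of the discrete group `G` is syndetic if `G = K S` for a finite set `K`. -/
def IsSyndeticSet {G : Type*} [Group G] (S : Set G) : Prop :=
  ∃ K : Set G, K.Finite ∧ K * S = Set.univ

/-- The set of return times `T_A(x) = {g | g x ∈ A}`. -/
def returnTimes (G : Type*) {X : Type*} [Group G] [MulAction G X] (A : Set X) (x : X) : Set G :=
  {g : G | g • x ∈ A}

/-- Every open neighbourhood of `x` has a syndetic subgroup among its return times. -/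
def IsRegularlyRecurrentPoint (G : Type*) {X : Type*} [Group G] [TopologicalSpace X]
    [MulAction G X] (x : X) : Prop :=
  ∀ V : Set X, IsOpen V → x ∈ V →
    ∃ Γ : Subgroup G, IsSyndeticSet (Γ : Set G) ∧ (Γ : Set G) ⊆ returnTimes G V x

/-- `X` is a Cantor set which is the orbit closure of a regularly recurrent point. -/
def IsRegularlyRecurrentCantorSystem (G X : Type*) [Group G] [TopologicalSpace X]
    [MulAction G X] : Prop :=
  Nonempty (X ≃ₜ cantorSet) ∧
    ∃ x : X, IsRegularlyRecurrentPoint G x ∧ closure (MulAction.orbit G x) = Set.univ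

/-! ### Nested sequences of Kakutani–Rohlin type partitions -/

/-- A sequence of finite clopen partitions
`P_n = {w C_{n,i} : w ∈ D_n, i < k_n}` with bases `C_n = ⋃_i C_{n,i}` and syndetic subgroups
`Γ_n`. -/
structure KRSequence (G X : Type*) [Group G] [TopologicalSpace X] [MulAction G X] where
  /-- the number of towers -/
  k : ℕ → ℕ
  /-- the pieces `C_{n,i}` of the base -/
  C : (n : ℕ) → Fin (k n) → Set X
  /-- the index set of the levels -/
  D : ℕ → Finset G
  /-- the group of return times to the base -/
  Γ : ℕ → Subgroup G
  isClopen : ∀ n i, IsClopen (C n i)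
  /-- `P_n` is a partition: its members are nonempty, pairwise disjoint and cover `X` -/
  nonempty : ∀ n i, (C n i).Nonempty
  disjoint : ∀ n, ∀ w ∈ D n, ∀ w' ∈ D n, ∀ i i', (w, i) ≠ (w', i') →
    Disjoint (w • C n i) (w' • C n i')
  cover : ∀ n, ∀ x : X, ∃ w ∈ D n, ∃ i, x ∈ w • C n i
  /-- `C_{n+1} ⊆ C_n` -/
  base_subset : ∀ n, (⋃ j, C (n + 1) j) ⊆ ⋃ i, C n i
  syndetic : ∀ n, IsSyndeticSet (Γ n : Set G)
  /-- `D_n` contains exactly one representative of each class of `G ⧸ Γ_n` -/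
  transversal : ∀ n, ∀ q : G ⧸ Γ n, ∃! w : G, w ∈ D n ∧ (w : G ⧸ Γ n) = q
  returnTimes_eq : ∀ n, ∀ x ∈ ⋃ i, C n i, returnTimes G (⋃ i, C n i) x = (Γ n : Set G)
  /-- `P_{n+1}` is finer than `P_n` -/
  finer : ∀ n, ∀ w ∈ D (n + 1), ∀ j, ∃ u ∈ D n, ∃ i, w • C (n + 1) j ⊆ u • C n i
  /-- the members of all the `P_n` span the topology of `X` -/
  spans : TopologicalSpace.IsTopologicalBasis
    {s : Set X | ∃ n, ∃ w ∈ D n, ∃ i, s = w • C n i}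

namespace KRSequence

variable {G X : Type*} [Group G] [TopologicalSpace X] [MulAction G X]

/-- The incidence matrix `A_n(i,j) = |{w ∈ D_{n+1} : w C_{n+1,j} ⊆ C_{n,i}}|`. -/
def incidence (P : KRSequence G X) (n : ℕ) : Matrix (Fin (P.k n)) (Fin (P.k (n + 1))) ℕ :=
  Matrix.of fun i j => Set.ncard {w : G | w ∈ P.D (n + 1) ∧ w • P.C (n + 1) j ⊆ P.C n i}

/-- Each level `u C_{n,i}` of the `i`-th tower of `P_n` contains exactly `A_n(i,j)` levels of the
`j`-th tower of `P_{n+1}`, independently of `u ∈ D_n`. -/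
def HasUniformIncidence (P : KRSequence G X) : Prop :=
  ∀ n, ∀ u ∈ P.D n, ∀ i j,
    Set.ncard {w : G | w ∈ P.D (n + 1) ∧ w • P.C (n + 1) j ⊆ u • P.C n i} = P.incidence n i j

/-- The simplex `Δ_n` of vectors with nonnegative entries and sum `1 / |D_n|`. -/
def simplex (P : KRSequence G X) (n : ℕ) : Set (Fin (P.k n) → ℝ) :=
  {x | (∀ i, 0 ≤ x i) ∧ ∑ i, x i = 1 / ((P.D n).card : ℝ)}

/-- The inverse limit of the maps `A_n : Δ_{n+1} → Δ_n`, as a subset of the product space (with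
the product topology and the coordinatewise convex structure). -/
def inverseLimit (P : KRSequence G X) : Set ((n : ℕ) → Fin (P.k n) → ℝ) :=
  {x | (∀ n, x n ∈ P.simplex n) ∧
    ∀ n, ((P.incidence n).map (fun a : ℕ => (a : ℝ))).mulVec (x (n + 1)) = x n}

end KRSequence

/-! ### Invariant probability measures -/

/-- The set `M_G(X)` of `G`-invariant Borel probability measures; as a subset of
`ProbabilityMeasure X` it carries the topology of weak convergence. -/
def invariantMeasures (G X : Type*) [Group G] [MeasurableSpace X] [MulAction G X] :
    Set (ProbabilityMeasure X) :=
  {μ | ∀ (g : G) (B : Set X), MeasurableSet B → (μ : Measure X) (g • B) = (μ : Measure X) B}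

/-- The convex combination `t μ + (1 - t) ν` of two invariant probability measures. -/
def invariantMix {G X : Type*} [Group G] [MeasurableSpace X] [MulAction G X]
    (t : Set.Icc (0 : ℝ) 1) (μ ν : invariantMeasures G X) : invariantMeasures G X :=
  ⟨⟨ENNReal.ofReal (t : ℝ) • ((μ : ProbabilityMeasure X) : Measure X) +
      ENNReal.ofReal (1 - (t : ℝ)) • ((ν : ProbabilityMeasure X) : Measure X), by
    constructor
    have h0 := t.2.1
    have h1 := t.2.2
    simp [← ENNReal.ofReal_add h0 (sub_nonneg.2 h1)]⟩, by
    intro g B hB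
    have hm := μ.2 g B hB
    have hn := ν.2 g B hB
    simp only [ProbabilityMeasure.coe_mk, Measure.add_apply, Measure.smul_apply, hm, hn]⟩

/-- The evaluations `μ ↦ (μ(C_{n,i}))_{n,i}` define an affine homeomorphism of `M_G(X)` onto the
inverse limit of the simplices `Δ_n` under the incidence matrices `A_n`. -/
def KRSequence.IsAffineHomeomorphicToInverseLimit {G X : Type*} [Group G] [TopologicalSpace X]
    [MeasurableSpace X] [BorelSpace X] [MulAction G X] (P : KRSequence G X) : Prop :=
  ∃ Φ : invariantMeasures G X ≃ₜ P.inverseLimit,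
    (∀ (t : Set.Icc (0 : ℝ) 1) (μ ν : invariantMeasures G X),
      (Φ (invariantMix t μ ν) : (n : ℕ) → Fin (P.k n) → ℝ) =
        (t : ℝ) • (Φ μ : (n : ℕ) → Fin (P.k n) → ℝ) +
          (1 - (t : ℝ)) • (Φ ν : (n : ℕ) → Fin (P.k n) → ℝ)) ∧
    ∀ (μ : invariantMeasures G X) (n : ℕ) (i : Fin (P.k n)),
      (Φ μ : (n : ℕ) → Fin (P.k n) → ℝ) n i =
        ((μ : ProbabilityMeasure X) : Measure X).real (P.C n i)

end

/-! (a) Incidence is uniform as soon as the new level set is tiled by the old one, `D' = D * E` with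
`E` inside the old return group `Γ`: the levels of the `j`-th new tower inside `u • C i` are then
the `u * e` with `e • C' j ⊆ C i`, a count free of `u` (`ncard_subset_eq_of_tiles`). To obtain such
a `D'`, take a late Følner transversal `F` of a smaller return group `Γ'`, and choose for each class
of `Γ` modulo `Γ'` a representative `γ` with `D * γ ⊆ F` whenever one exists. The points of `F` lost
in this way lie in a boundary layer of `F` determined by the fixed set `D`, which is a negligible
proportion of `F`; so `D'` is almost as invariant as `F` (`exists_tiled_transversal`). Changing the
transversal keeps the base and its translates, and cutting the base finely enough makes the new
partition refine the old ones (`exists_refinement`).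

(b) An invariant measure gives all levels of a tower the same mass, so its values on the pieces of
the bases form a point of the inverse limit. They determine the measure, because the cells of all
partitions form a π-system generating the Borel sets (`measure_ext_of_cells`). Conversely, a point
of the inverse limit prescribes masses for all cells; uniform incidence makes these consistent on
every level, not only on the base, and a weak cluster point of Dirac combinations realises them
(`exists_measure_of_mem_inverseLimit`). That measure is invariant because `g` permutes the levels of
each tower except for a proportion that vanishes by the Følner property
(`mem_invariantMeasures_of_cells`). Finally, the cells are a clopen basis, so weak convergence
amounts to convergence on cells, which gives continuity in both directions. -/

/-- A finite clopen partition `{w C_i : w ∈ D, i < k}` of Kakutani–Rohlin type whose base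
`⋃ i, C_i` has the subgroup `Γ` as its set of return times. -/
structure KRPartition (G X : Type*) [Group G] [TopologicalSpace X] [MulAction G X] where
  /-- the number of towers -/
  k : ℕ
  /-- the pieces of the base -/
  C : Fin k → Set X
  /-- the index set of the levels -/
  D : Finset G
  /-- the group of return times to the base -/
  Γ : Subgroup G
  isClopen : ∀ i, IsClopen (C i)
  nonempty : ∀ i, (C i).Nonempty
  disjoint : ∀ w ∈ D, ∀ w' ∈ D, ∀ i i', (w, i) ≠ (w', i') → Disjoint (w • C i) (w' • C i')
  cover : ∀ x : X, ∃ w ∈ D, ∃ i, x ∈ w • C i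
  transversal : ∀ q : G ⧸ Γ, ∃! w : G, w ∈ D ∧ (w : G ⧸ Γ) = q
  smul_mem_iff : ∀ x ∈ ⋃ i, C i, ∀ g : G, g • x ∈ ⋃ i, C i ↔ g ∈ Γ

/-! ### Single partitions: addresses, translates of the base, refinements. -/

namespace KRPartition

variable {G X : Type*} [Group G] [TopologicalSpace X] [MulAction G X]

/-- The base of a Kakutani–Rohlin partition. -/
def base (Q : KRPartition G X) : Set X := ⋃ i, Q.C i

/-- The pairs indexing the members of the partition. -/
def idx (Q : KRPartition G X) : Finset (G × Fin Q.k) := Q.D ×ˢ Finset.univ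

/-- The member of the partition indexed by a pair. -/
def cell (Q : KRPartition G X) (p : G × Fin Q.k) : Set X := p.1 • Q.C p.2

/-- Every member of the partition `Q'` is contained in a member of `Q`. -/
def Refines (Q' Q : KRPartition G X) : Prop :=
  ∀ p ∈ Q'.idx, ∃ q ∈ Q.idx, Q'.cell p ⊆ Q.cell q

theorem mem_idx {Q : KRPartition G X} {p : G × Fin Q.k} : p ∈ Q.idx ↔ p.1 ∈ Q.D := by
  simp [idx]

theorem Refines.refl (Q : KRPartition G X) : Q.Refines Q := fun p hp => ⟨p, hp, subset_rfl⟩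

theorem Refines.trans {Q₁ Q₂ Q₃ : KRPartition G X} (h : Q₁.Refines Q₂) (h' : Q₂.Refines Q₃) :
    Q₁.Refines Q₃ := fun p hp => by
  obtain ⟨q, hq, hpq⟩ := h p hp
  obtain ⟨r, hr, hqr⟩ := h' q hq
  exact ⟨r, hr, hpq.trans hqr⟩

theorem cell_nonempty (Q : KRPartition G X) (p : G × Fin Q.k) : (Q.cell p).Nonempty :=
  (Q.nonempty p.2).smul_set

theorem isClopen_cell [ContinuousConstSMul G X] (Q : KRPartition G X) (p : G × Fin Q.k) :
    IsClopen (Q.cell p) :=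
  ⟨(Q.isClopen p.2).1.smul p.1, (Q.isClopen p.2).2.smul p.1⟩

theorem eq_of_mem_cell {Q : KRPartition G X} {p q : G × Fin Q.k} (hp : p ∈ Q.idx) (hq : q ∈ Q.idx)
    {x : X} (hxp : x ∈ Q.cell p) (hxq : x ∈ Q.cell q) : p = q := by
  by_contra h
  exact Set.disjoint_left.1
    (Q.disjoint p.1 (mem_idx.1 hp) q.1 (mem_idx.1 hq) p.2 q.2 h) hxp hxq

theorem exists_mem_cell (Q : KRPartition G X) (x : X) : ∃ p ∈ Q.idx, x ∈ Q.cell p := by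
  obtain ⟨w, hw, i, hx⟩ := Q.cover x
  exact ⟨(w, i), mem_idx.2 hw, hx⟩

/-- The index of the member of the partition which contains a point. -/
noncomputable def addr (Q : KRPartition G X) (x : X) : G × Fin Q.k := (Q.exists_mem_cell x).choose

theorem addr_mem_idx (Q : KRPartition G X) (x : X) : Q.addr x ∈ Q.idx :=
  (Q.exists_mem_cell x).choose_spec.1

theorem mem_cell_addr (Q : KRPartition G X) (x : X) : x ∈ Q.cell (Q.addr x) :=
  (Q.exists_mem_cell x).choose_spec.2

theorem isLocallyConstant_addr [ContinuousConstSMul G X] (Q : KRPartition G X) :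
    IsLocallyConstant Q.addr := by
  rw [IsLocallyConstant.iff_exists_open]
  intro x
  exact ⟨Q.cell (Q.addr x), (Q.isClopen_cell _).2, Q.mem_cell_addr x, fun y hy =>
    eq_of_mem_cell (Q.addr_mem_idx y) (Q.addr_mem_idx x) (Q.mem_cell_addr y) hy⟩

theorem C_subset_base (Q : KRPartition G X) (i : Fin Q.k) : Q.C i ⊆ Q.base :=
  Set.subset_iUnion Q.C i

theorem base_nonempty [Nonempty X] (Q : KRPartition G X) : Q.base.Nonempty := by
  obtain ⟨x⟩ := ‹Nonempty X›
  exact (Q.nonempty (Q.addr x).2).mono (Q.C_subset_base _)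

theorem cell_subset_smul_base (Q : KRPartition G X) (p : G × Fin Q.k) :
    Q.cell p ⊆ p.1 • Q.base :=
  Set.smul_set_mono (Q.C_subset_base _)

theorem smul_mem_base_iff {Q : KRPartition G X} {x : X} (hx : x ∈ Q.base) {g : G} :
    g • x ∈ Q.base ↔ g ∈ Q.Γ := Q.smul_mem_iff x hx g

theorem mk_eq_of_mem {Q : KRPartition G X} {v w : G} {x : X} (hv : x ∈ v • Q.base)
    (hw : x ∈ w • Q.base) : (v : G ⧸ Q.Γ) = w := by
  rw [Set.mem_smul_set_iff_inv_smul_mem] at hv hw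
  rw [eq_comm, QuotientGroup.eq, ← smul_mem_base_iff hv, smul_smul]
  simpa using hw

theorem smul_base_subset {Q : KRPartition G X} {v w : G} (h : (v : G ⧸ Q.Γ) = w) :
    v • Q.base ⊆ w • Q.base := by
  rintro _ ⟨y, hy, rfl⟩
  rw [Set.mem_smul_set_iff_inv_smul_mem]
  simp only [smul_smul]
  exact (smul_mem_base_iff hy).2 (QuotientGroup.eq.1 h.symm)

theorem smul_base_eq {Q : KRPartition G X} {v w : G} (h : (v : G ⧸ Q.Γ) = w) :
    v • Q.base = w • Q.base :=
  (smul_base_subset h).antisymm (smul_base_subset h.symm)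

theorem eq_of_mk_eq {Q : KRPartition G X} {v w : G} (hv : v ∈ Q.D) (hw : w ∈ Q.D)
    (h : (v : G ⧸ Q.Γ) = w) : v = w :=
  (Q.transversal w).unique ⟨hv, h⟩ ⟨hw, rfl⟩

theorem exists_mk_eq (Q : KRPartition G X) (g : G) : ∃ w ∈ Q.D, (w : G ⧸ Q.Γ) = g :=
  (Q.transversal g).exists

theorem isClopen_base (Q : KRPartition G X) : IsClopen Q.base :=
  isClopen_iUnion_of_finite Q.isClopen

theorem isSyndeticSet (Q : KRPartition G X) : IsSyndeticSet (Q.Γ : Set G) := by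
  refine ⟨Q.D, Q.D.finite_toSet, Set.eq_univ_of_forall fun g => ?_⟩
  obtain ⟨w, hw, h⟩ := Q.exists_mk_eq g
  exact ⟨w, hw, w⁻¹ * g, QuotientGroup.eq.1 h, by simp⟩

theorem Γ_le_of_base_subset [Nonempty X] {Q Q' : KRPartition G X} (h : Q'.base ⊆ Q.base) :
    Q'.Γ ≤ Q.Γ := by
  obtain ⟨x, hx⟩ := Q'.base_nonempty
  intro g hg
  exact (smul_mem_base_iff (h hx)).1 (h ((smul_mem_base_iff hx).2 hg))

theorem exists_enum_image {T : Type*} [CompactSpace X] {f : X → T} (hf : IsLocallyConstant f)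
    (S : Set X) : ∃ k : ℕ, Nonempty (Fin k ≃ (f '' S : Set T)) := by
  have : Finite (f '' S : Set T) := (hf.range_finite.subset (Set.image_subset_range f S)).to_subtype
  obtain ⟨k, ⟨e⟩⟩ := Finite.exists_equiv_fin (f '' S : Set T)
  exact ⟨k, ⟨e.symm⟩⟩

/-- The levels of a Kakutani–Rohlin partition may be indexed by another transversal, and its base
may be cut along the fibres of a locally constant function. -/
theorem exists_recut {T : Type*} [CompactSpace X] (R : KRPartition G X) {D : Finset G}
    (hD : ∀ q : G ⧸ R.Γ, ∃! w : G, w ∈ D ∧ (w : G ⧸ R.Γ) = q)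
    {f : X → T} (hf : IsLocallyConstant f) :
    ∃ Q : KRPartition G X, Q.D = D ∧ Q.Γ = R.Γ ∧ Q.base = R.base ∧
      ∀ i, ∀ x ∈ Q.C i, ∀ y ∈ Q.C i, f x = f y := by
  -- Only values attained on the base are enumerated, so that no piece is empty.
  obtain ⟨k, ⟨e⟩⟩ := exists_enum_image hf R.base
  have hU : (⋃ i, R.base ∩ f ⁻¹' {(e i : T)}) = R.base := by
    ext x
    simp only [Set.mem_iUnion, Set.mem_inter_iff, Set.mem_preimage, Set.mem_singleton_iff]
    refine ⟨fun ⟨_, h, _⟩ => h, fun h => ⟨e.symm ⟨f x, x, h, rfl⟩, h, by simp⟩⟩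
  refine ⟨{
    k := k
    C := fun i => R.base ∩ f ⁻¹' {(e i : T)}
    D := D
    Γ := R.Γ
    isClopen := fun i => R.isClopen_base.inter (hf.isClopen_fiber _)
    nonempty := fun i => by
      obtain ⟨x, hx, h⟩ := (e i).2
      exact ⟨x, hx, h⟩
    disjoint := ?_
    cover := ?_
    transversal := hD
    smul_mem_iff := ?_ }, rfl, rfl, hU, ?_⟩
  · intro w hw w' hw' i i' hne
    rw [Set.disjoint_left]
    intro x hx hx'
    have hww : w = w' := (hD w').unique ⟨hw, mk_eq_of_mem
      (Set.smul_set_mono Set.inter_subset_left hx)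
      (Set.smul_set_mono Set.inter_subset_left hx')⟩ ⟨hw', rfl⟩
    subst hww
    rw [Set.mem_smul_set_iff_inv_smul_mem] at hx hx'
    have : (e i : T) = e i' := hx.2.symm.trans hx'.2
    exact hne (by rw [e.injective (Subtype.ext this)])
  · intro x
    obtain ⟨w, ⟨hw, h⟩, -⟩ := hD ((R.addr x).1)
    have hx := R.cell_subset_smul_base _ (R.mem_cell_addr x)
    rw [← smul_base_eq h, ← hU, Set.smul_set_iUnion] at hx
    exact ⟨w, hw, Set.mem_iUnion.1 hx⟩
  · rw [hU]
    exact R.smul_mem_iff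
  · intro i x hx y hy
    exact hx.2.trans hy.2.symm

/-- A Kakutani–Rohlin partition with the base of `R` and a prescribed transversal as index set of
its levels can be chosen to refine both `R` and any other Kakutani–Rohlin partition. -/
theorem exists_refinement [CompactSpace X] [ContinuousConstSMul G X] (R Q : KRPartition G X)
    {D : Finset G} (hD : ∀ q : G ⧸ R.Γ, ∃! w : G, w ∈ D ∧ (w : G ⧸ R.Γ) = q) :
    ∃ Q' : KRPartition G X, Q'.D = D ∧ Q'.Γ = R.Γ ∧ Q'.base = R.base ∧
      Q'.Refines R ∧ Q'.Refines Q := by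
  -- The base is cut by the itinerary of a point: its addresses in `R` and `Q` after applying each
  -- `w ∈ D`. Each level of a piece then lies in a single cell of both.
  have hf : IsLocallyConstant fun (x : X) (w : D) =>
      (R.addr ((w : G) • x), Q.addr ((w : G) • x)) := by
    rw [IsLocallyConstant.iff_eventually_eq]
    intro x
    have h : ∀ w : D, ∀ᶠ y in 𝓝 x, (R.addr ((w : G) • y), Q.addr ((w : G) • y)) =
        (R.addr ((w : G) • x), Q.addr ((w : G) • x)) := fun w =>
      ((R.isLocallyConstant_addr.prodMk Q.isLocallyConstant_addr).comp_continuous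
        (continuous_const_smul (w : G))).eventually_eq x
    filter_upwards [eventually_all.2 h] with y hy
    exact funext hy
  obtain ⟨Q', hQD, hQΓ, hQb, hQ⟩ := R.exists_recut hD hf
  refine ⟨Q', hQD, hQΓ, hQb, ?_, ?_⟩
  all_goals
    intro p hp
    obtain ⟨x, hx⟩ := Q'.nonempty p.2
    have hw : p.1 ∈ D := hQD ▸ mem_idx.1 hp
  · refine ⟨_, R.addr_mem_idx (p.1 • x), ?_⟩
    rintro _ ⟨y, hy, rfl⟩
    have h : R.addr (p.1 • y) = R.addr (p.1 • x) :=
      congrArg Prod.fst (congrFun (hQ p.2 y hy x hx) ⟨p.1, hw⟩)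
    exact h ▸ R.mem_cell_addr (p.1 • y)
  · refine ⟨_, Q.addr_mem_idx (p.1 • x), ?_⟩
    rintro _ ⟨y, hy, rfl⟩
    have h : Q.addr (p.1 • y) = Q.addr (p.1 • x) :=
      congrArg Prod.snd (congrFun (hQ p.2 y hy x hx) ⟨p.1, hw⟩)
    exact h ▸ Q.mem_cell_addr (p.1 • y)

end KRPartition

/-! ### Passing between sequences and their individual partitions. -/

namespace KRSequence

variable {G X : Type*} [Group G] [TopologicalSpace X] [MulAction G X]

/-- The `n`-th partition of a Kakutani–Rohlin sequence. -/
def level (P : KRSequence G X) (n : ℕ) : KRPartition G X where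
  k := P.k n
  C := P.C n
  D := P.D n
  Γ := P.Γ n
  isClopen := P.isClopen n
  nonempty := P.nonempty n
  disjoint := P.disjoint n
  cover := P.cover n
  transversal := P.transversal n
  smul_mem_iff := fun x hx g => Set.ext_iff.1 (P.returnTimes_eq n x hx) g

theorem level_refines (P : KRSequence G X) {m n : ℕ} (h : m ≤ n) :
    (P.level n).Refines (P.level m) := by
  induction n, h using Nat.le_induction with
  | base => exact KRPartition.Refines.refl _
  | succ n _ ih =>
    refine KRPartition.Refines.trans (fun p hp => ?_) ih
    obtain ⟨u, hu, i, h⟩ := P.finer n p.1 (KRPartition.mem_idx.1 hp) p.2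
    exact ⟨(u, i), KRPartition.mem_idx.2 hu, h⟩

theorem level_base_antitone (P : KRSequence G X) : Antitone fun n => (P.level n).base :=
  antitone_nat_of_succ_le P.base_subset

/-- A sequence of Kakutani–Rohlin partitions with nested bases, each of which refines the
preceding one, is a Kakutani–Rohlin sequence if it is eventually finer than the partitions of
a given one. -/
def ofLevels [ContinuousConstSMul G X] (Q : ℕ → KRPartition G X)
    (hb : ∀ n, (Q (n + 1)).base ⊆ (Q n).base)
    (hr : ∀ n, (Q (n + 1)).Refines (Q n)) (P : KRSequence G X)
    (hP : ∀ m, ∃ n, (Q n).Refines (P.level m)) : KRSequence G X where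
  k n := (Q n).k
  C n := (Q n).C
  D n := (Q n).D
  Γ n := (Q n).Γ
  isClopen n := (Q n).isClopen
  nonempty n := (Q n).nonempty
  disjoint n := (Q n).disjoint
  cover n := (Q n).cover
  base_subset := hb
  syndetic n := (Q n).isSyndeticSet
  transversal n := (Q n).transversal
  returnTimes_eq n x hx := Set.ext fun g => (Q n).smul_mem_iff x hx g
  finer n w hw j := by
    obtain ⟨p, hp, h⟩ := hr n (w, j) (KRPartition.mem_idx.2 hw)
    exact ⟨p.1, KRPartition.mem_idx.1 hp, p.2, h⟩
  spans := by
    refine TopologicalSpace.isTopologicalBasis_of_isOpen_of_nhds ?_ fun x U hx hU => ?_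
    · rintro _ ⟨n, w, -, i, rfl⟩
      exact ((Q n).isClopen_cell (w, i)).2
    · obtain ⟨_, ⟨m, w, hw, i, rfl⟩, hxA, hAU⟩ := P.spans.exists_subset_of_mem_open hx hU
      obtain ⟨n, hn⟩ := hP m
      refine ⟨_, ⟨n, _, KRPartition.mem_idx.1 ((Q n).addr_mem_idx x), _, rfl⟩,
        (Q n).mem_cell_addr x, ?_⟩
      obtain ⟨q, hq, h⟩ := hn _ ((Q n).addr_mem_idx x)
      have : q = (w, i) := KRPartition.eq_of_mem_cell hq (KRPartition.mem_idx.2 hw)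
        (h ((Q n).mem_cell_addr x)) hxA
      subst this
      exact h.trans hAU

end KRSequence

/-! ### Transversals, Følner estimates and tilings in the group. -/

section Transversal

variable {G : Type*} [Group G]

/-- The finite set `D` contains exactly one representative of each class of `G ⧸ H`. -/
def IsLeftTransversal (D : Finset G) (H : Subgroup G) : Prop :=
  ∀ q : G ⧸ H, ∃! w : G, w ∈ D ∧ (w : G ⧸ H) = q

theorem IsLeftTransversal.eq_of_mk_eq {D : Finset G} {H : Subgroup G} (hD : IsLeftTransversal D H)
    {v w : G} (hv : v ∈ D) (hw : w ∈ D) (h : (v : G ⧸ H) = w) : v = w :=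
  (hD w).unique ⟨hv, h⟩ ⟨hw, rfl⟩

theorem IsLeftTransversal.exists_mk_eq {D : Finset G} {H : Subgroup G}
    (hD : IsLeftTransversal D H) (g : G) : ∃ w ∈ D, (w : G ⧸ H) = g := (hD g).exists

theorem IsLeftTransversal.card_le {D F : Finset G} {H : Subgroup G} (hD : IsLeftTransversal D H)
    (hF : IsLeftTransversal F H) : D.card ≤ F.card := by
  choose r hr hr' using hF.exists_mk_eq
  refine Finset.card_le_card_of_injOn r (fun d _ => hr d) fun a ha b hb hab => ?_
  exact hD.eq_of_mk_eq ha hb (by rw [← hr' a, ← hr' b, hab])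

theorem IsLeftTransversal.card_eq {D F : Finset G} {H : Subgroup G} (hD : IsLeftTransversal D H)
    (hF : IsLeftTransversal F H) : D.card = F.card := (hD.card_le hF).antisymm (hF.card_le hD)

theorem mk_mul_eq_mk_mul_of_mem {H : Subgroup G} {v w t : G} (h : (v : G ⧸ H) = w) (ht : t ∈ H) :
    ((v * t : G) : G ⧸ H) = w := by
  rw [QuotientGroup.mk_mul_of_mem v ht, h]

theorem mk_eq_mk_of_le {H K : Subgroup G} (hHK : H ≤ K) {v w : G} (h : (v : G ⧸ H) = w) :
    (v : G ⧸ K) = w := QuotientGroup.eq.2 (hHK (QuotientGroup.eq.1 h))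

theorem mk_mul_left_eq {H : Subgroup G} {v w : G} (u : G) (h : (v : G ⧸ H) = w) :
    ((u * v : G) : G ⧸ H) = (u * w : G) := by
  rw [QuotientGroup.eq] at h ⊢
  simpa [mul_assoc] using h

theorem mk_eq_of_mk_mul_left_eq {H : Subgroup G} {u v w : G}
    (h : ((u * v : G) : G ⧸ H) = (u * w : G)) : (v : G ⧸ H) = w := by
  simpa using mk_mul_left_eq u⁻¹ h

theorem mem_op_smul_finset_iff [DecidableEq G] {D : Finset G} {t g : G} :
    g ∈ MulOpposite.op t • D ↔ g * t⁻¹ ∈ D := by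
  rw [← Finset.inv_smul_mem_iff]
  simp

theorem IsLeftTransversal.op_smul [DecidableEq G] {D : Finset G} {H : Subgroup G}
    (hD : IsLeftTransversal D H) {t : G} (ht : t ∈ H) :
    IsLeftTransversal (MulOpposite.op t • D) H := by
  intro q
  obtain ⟨w, ⟨hw, rfl⟩, hu⟩ := hD q
  refine ⟨w * t, ⟨by simpa [mem_op_smul_finset_iff] using hw, mk_mul_eq_mk_mul_of_mem rfl ht⟩, ?_⟩
  rintro v ⟨hv, hvw⟩
  rw [mem_op_smul_finset_iff] at hv
  rw [← hu (v * t⁻¹) ⟨hv, mk_mul_eq_mk_mul_of_mem hvw (H.inv_mem ht)⟩]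
  simp

/-- Left and right translations commute, so a right translation costs nothing in the Følner
quotient. -/
theorem ncard_smul_symmDiff_op_smul [DecidableEq G] (D : Finset G) (t g : G) :
    Set.ncard ((g • ((MulOpposite.op t • D : Finset G) : Set G)) ∆
      ((MulOpposite.op t • D : Finset G) : Set G)) =
    Set.ncard ((g • (D : Set G)) ∆ (D : Set G)) := by
  rw [Finset.coe_smul_finset, smul_comm, ← Set.smul_set_symmDiff]
  exact Set.ncard_image_of_injective _ (MulAction.injective _)

theorem card_filter_mul_notMem_le [DecidableEq G] (F : Finset G) (g : G) :
    (F.filter fun d => g * d ∉ F).card ≤ Set.ncard ((g • (F : Set G)) ∆ (F : Set G)) := by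
  have hfin : ((g • (F : Set G)) ∆ (F : Set G)).Finite :=
    (F.finite_toSet.smul_set).symmDiff F.finite_toSet
  rw [← Set.ncard_coe_finset]
  refine Set.ncard_le_ncard_of_injOn (g * ·) ?_ (mul_right_injective g).injOn hfin
  intro d hd
  simp only [Finset.coe_filter, Set.mem_ofPred_eq] at hd
  exact Or.inl ⟨⟨d, hd.1, rfl⟩, hd.2⟩

/-- Equal cardinality turns the one-sided bound on `F \ D` into `2 * B.card` for `D ∆ F`. This is
paid twice, on the path `g • D`, `g • F`, `F`, `D`. -/
theorem ncard_smul_symmDiff_le_of_sdiff_subset {D F B : Finset G} [DecidableEq G]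
    (hcard : D.card = F.card) (hB : F \ D ⊆ B) (g : G) :
    Set.ncard ((g • (D : Set G)) ∆ (D : Set G)) ≤
      Set.ncard ((g • (F : Set G)) ∆ (F : Set G)) + 4 * B.card := by
  have hDF : Set.ncard ((D : Set G) ∆ (F : Set G)) ≤ 2 * B.card := by
    have h1 : (F \ D).card ≤ B.card := Finset.card_le_card hB
    have h2 : (D \ F).card = (F \ D).card := Finset.card_sdiff_comm hcard
    rw [Set.symmDiff_def, ← Finset.coe_sdiff, ← Finset.coe_sdiff]
    refine (Set.ncard_union_le _ _).trans ?_
    rw [Set.ncard_coe_finset, Set.ncard_coe_finset]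
    omega
  have hfD : (D : Set G).Finite := D.finite_toSet
  have hfF : (F : Set G).Finite := F.finite_toSet
  have h1 : (g • (D : Set G)) ∆ (D : Set G) ⊆ ((g • (D : Set G)) ∆ (g • (F : Set G))) ∪
      (((g • (F : Set G)) ∆ (F : Set G)) ∪ ((F : Set G) ∆ (D : Set G))) :=
    (symmDiff_triangle _ (g • (F : Set G)) _).trans
      (sup_le_sup_left (symmDiff_triangle _ (F : Set G) _) _)
  have h2 := Set.ncard_le_ncard h1 ((hfD.smul_set.symmDiff hfF.smul_set).union
    ((hfF.smul_set.symmDiff hfF).union (hfF.symmDiff hfD)))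
  have h3 := Set.ncard_union_le ((g • (D : Set G)) ∆ (g • (F : Set G)))
    (((g • (F : Set G)) ∆ (F : Set G)) ∪ ((F : Set G) ∆ (D : Set G)))
  have h4 := Set.ncard_union_le ((g • (F : Set G)) ∆ (F : Set G)) ((F : Set G) ∆ (D : Set G))
  have h5 : Set.ncard ((g • (D : Set G)) ∆ (g • (F : Set G))) =
      Set.ncard ((D : Set G) ∆ (F : Set G)) := by
    rw [← Set.smul_set_symmDiff]
    exact Set.ncard_image_of_injective _ (MulAction.injective _)
  rw [symmDiff_comm (F : Set G) (D : Set G)] at h4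
  rw [symmDiff_comm (F : Set G) (D : Set G)] at h3 h2
  omega

/-- The points `d` of `F` for which a translate `D γ` containing `d` need not lie inside `F`. -/
def tileDefect [DecidableEq G] (D F : Finset G) : Finset G :=
  F.filter fun d => ∃ p ∈ D ×ˢ D, p.2 * p.1⁻¹ * d ∉ F

theorem card_tileDefect_le [DecidableEq G] (D F : Finset G) :
    (tileDefect D F).card ≤
      ∑ p ∈ D ×ˢ D, Set.ncard (((p.2 * p.1⁻¹) • (F : Set G)) ∆ (F : Set G)) := by
  have : tileDefect D F ⊆ (D ×ˢ D).biUnion fun p => F.filter fun d => p.2 * p.1⁻¹ * d ∉ F := by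
    intro d hd
    obtain ⟨hd, p, hp, h⟩ := Finset.mem_filter.1 hd
    exact Finset.mem_biUnion.2 ⟨p, hp, Finset.mem_filter.2 ⟨hd, h⟩⟩
  exact (Finset.card_le_card this).trans (Finset.card_biUnion_le.trans
    (Finset.sum_le_sum fun p _ => card_filter_mul_notMem_le F _))

/-- A transversal `F` of `Γ'` can be replaced by one which is tiled by right translates of a
transversal `D` of a larger subgroup `Γ`, at the cost of the points in `tileDefect D F`. -/
theorem exists_tiled_transversal [DecidableEq G] {Γ Γ' : Subgroup G} (hΓ : Γ' ≤ Γ) {D F : Finset G}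
    (hD : IsLeftTransversal D Γ) (h1 : 1 ∈ D) (hF : IsLeftTransversal F Γ') :
    ∃ E : Finset G, (∀ e ∈ E, e ∈ Γ) ∧ IsLeftTransversal (D * E) Γ' ∧ 1 ∈ D * E ∧
      ∀ g : G, Set.ncard ((g • ((D * E : Finset G) : Set G)) ∆ ((D * E : Finset G) : Set G)) ≤
        Set.ncard ((g • (F : Set G)) ∆ (F : Set G)) + 4 * (tileDefect D F).card := by
  classical
  -- A representative whose whole tile `D * γ` lies in `F` is preferred. It is unique: since `1 ∈
  -- D`, it belongs to `F`, which meets each class once.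
  have hrep : ∀ q : G ⧸ Γ', ∃ e : G, (e : G ⧸ Γ') = q ∧
      ∀ γ ∈ Γ, (γ : G ⧸ Γ') = q → (∀ u ∈ D, u * γ ∈ F) → e = γ := by
    intro q
    by_cases h : ∃ γ ∈ Γ, (γ : G ⧸ Γ') = q ∧ ∀ u ∈ D, u * γ ∈ F
    · obtain ⟨e, -, heq, heF⟩ := h
      refine ⟨e, heq, fun γ _ hγ hγF => ?_⟩
      have := hF.eq_of_mk_eq (heF 1 h1) (hγF 1 h1) (by simp [heq, hγ])
      simpa using this
    · exact ⟨q.out, q.out_eq', fun γ hγ hγq hγF => (h ⟨γ, hγ, hγq, hγF⟩).elim⟩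
  choose rep rep_mk rep_eq using hrep
  set E : Finset G := (F.filter (· ∈ Γ)).image fun f : G => rep (f : G ⧸ Γ') with hE
  have mem_of_mk : ∀ {a b : G}, (a : G ⧸ Γ') = b → b ∈ Γ → a ∈ Γ := by
    intro a b hab hb
    have := hΓ (QuotientGroup.eq.1 hab.symm)
    simpa using Γ.mul_mem hb this
  have hEΓ : ∀ e ∈ E, e ∈ Γ := by
    intro e he
    obtain ⟨f, hf, rfl⟩ := Finset.mem_image.1 he
    exact mem_of_mk (rep_mk f) (Finset.mem_filter.1 hf).2
  have hrepE : ∀ γ ∈ Γ, rep γ ∈ E := by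
    intro γ hγ
    obtain ⟨f, hf, hfγ⟩ := hF.exists_mk_eq γ
    refine Finset.mem_image.2 ⟨f, Finset.mem_filter.2 ⟨hf, mem_of_mk hfγ hγ⟩, ?_⟩
    rw [hfγ]
  have hEeq : ∀ e ∈ E, rep e = e := by
    intro e he
    obtain ⟨f, hf, rfl⟩ := Finset.mem_image.1 he
    rw [rep_mk]
  have htr : IsLeftTransversal (D * E) Γ' := by
    intro q
    obtain ⟨g, rfl⟩ := QuotientGroup.mk_surjective q
    obtain ⟨u, hu, hug⟩ := hD.exists_mk_eq g
    have hγ : u⁻¹ * g ∈ Γ := QuotientGroup.eq.1 hug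
    refine ⟨u * rep (u⁻¹ * g : G), ⟨Finset.mul_mem_mul hu (hrepE _ hγ), ?_⟩, ?_⟩
    · simpa using mk_mul_left_eq u (rep_mk (u⁻¹ * g : G))
    · rintro v ⟨hv, hvg⟩
      obtain ⟨u', hu', e, he, rfl⟩ := Finset.mem_mul.1 hv
      have huu : u' = u := by
        refine hD.eq_of_mk_eq hu' hu ?_
        rw [hug, ← mk_eq_mk_of_le hΓ hvg, QuotientGroup.mk_mul_of_mem u' (hEΓ e he)]
      subst huu
      have : (e : G ⧸ Γ') = (u'⁻¹ * g : G) :=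
        mk_eq_of_mk_mul_left_eq (u := u') (by simpa using hvg)
      rw [← this, hEeq e he]
  -- Write `d = u * γ` with `u ∈ D`, `γ ∈ Γ`. Outside the defect every `v * γ = v * u⁻¹ * d` is in
  -- `F`, so `γ` is the preferred representative and `d ∈ D * E`.
  have hsub : F \ (D * E) ⊆ tileDefect D F := by
    intro d hd
    obtain ⟨hdF, hd⟩ := Finset.mem_sdiff.1 hd
    by_contra hcon
    refine hd ?_
    obtain ⟨u, hu, hud⟩ := hD.exists_mk_eq d
    have hγ : u⁻¹ * d ∈ Γ := QuotientGroup.eq.1 hud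
    have hall : ∀ v ∈ D, v * (u⁻¹ * d) ∈ F := by
      intro v hv
      by_contra hvF
      exact hcon (Finset.mem_filter.2 ⟨hdF, (u, v), Finset.mk_mem_product hu hv, by
        simpa [mul_assoc] using hvF⟩)
    have := rep_eq _ _ hγ rfl hall
    have hmem := Finset.mul_mem_mul hu (hrepE _ hγ)
    rw [this] at hmem
    simpa using hmem
  -- The representative of the trivial class need not be `1`; right translation by its inverse, an
  -- element of `Γ'`, puts `1` into the product so that the construction can be iterated.
  have hone : rep (1 : G) ∈ Γ' := by
    simpa using QuotientGroup.eq.1 (rep_mk (1 : G)).symm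
  have hmul : D * (MulOpposite.op (rep (1 : G))⁻¹ • E) =
      MulOpposite.op (rep (1 : G))⁻¹ • (D * E) := mul_smul_comm _ _ _
  refine ⟨MulOpposite.op (rep (1 : G))⁻¹ • E, ?_, ?_, ?_, ?_⟩
  · intro e he
    rw [mem_op_smul_finset_iff, inv_inv] at he
    have := Γ.mul_mem (hEΓ _ he) (Γ.inv_mem (hΓ hone))
    simpa using this
  · rw [hmul]
    exact htr.op_smul (Γ'.inv_mem hone)
  · refine Finset.mem_mul.2 ⟨1, h1, 1, ?_, by simp⟩
    rw [mem_op_smul_finset_iff]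
    simpa using hrepE 1 Γ.one_mem
  · intro g
    rw [hmul, ncard_smul_symmDiff_op_smul]
    exact ncard_smul_symmDiff_le_of_sdiff_subset (htr.card_eq hF) hsub g

theorem tendsto_card_tileDefect_div [DecidableEq G] {F : ℕ → Finset G} (hF : IsFolnerSequence F)
    (D : Finset G) :
    Tendsto (fun n => ((tileDefect D (F n)).card : ℝ) / ((F n).card : ℝ)) atTop (𝓝 0) := by
  have h : Tendsto (fun n => ∑ p ∈ D ×ˢ D,
      (Set.ncard (((p.2 * p.1⁻¹) • (F n : Set G)) ∆ (F n : Set G)) : ℝ) / ((F n).card : ℝ))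
      atTop (𝓝 0) := by
    simpa using tendsto_finsetSum (D ×ˢ D) fun p _ => hF.2 (p.2 * p.1⁻¹)
  refine squeeze_zero (fun n => by positivity) (fun n => ?_) h
  rw [← Finset.sum_div]
  gcongr
  exact_mod_cast card_tileDefect_le D (F n)

end Transversal

/-! ### Construction of a Følner sequence with uniform incidence. -/

namespace KRSequence

variable {G X : Type*} [Group G] [TopologicalSpace X] [MulAction G X]

/-- A Kakutani–Rohlin partition with the base of the `m`-th partition of `P` which refines that
partition, and whose levels are indexed by a set containing `1`. -/
structure Adapted (P : KRSequence G X) (m : ℕ) (Q : KRPartition G X) : Prop where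
  base_eq : Q.base = (P.level m).base
  one_mem : 1 ∈ Q.D
  refines : Q.Refines (P.level m)

/-- Right translation by an element of the return group brings `1` into the level set; this changes
the cells, so the base is cut again to refine the original partition. -/
theorem exists_adapted [CompactSpace X] [ContinuousConstSMul G X] (P : KRSequence G X) (m : ℕ) :
    ∃ Q, P.Adapted m Q := by
  classical
  obtain ⟨w, hw, hw1⟩ := (P.level m).exists_mk_eq 1
  have ht : w⁻¹ ∈ (P.level m).Γ := by simpa using QuotientGroup.eq.1 hw1
  obtain ⟨Q, hQD, -, hQb, hQr, -⟩ := (P.level m).exists_refinement (P.level m)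
    (IsLeftTransversal.op_smul (P.level m).transversal ht)
  exact ⟨Q, hQb, by rw [hQD, mem_op_smul_finset_iff]; simpa using hw, hQr⟩

/-- The relation between consecutive members of a sequence of partitions with almost invariant
sets of levels and uniform incidence. -/
structure TiledStep (P : KRSequence G X) (ε : ℝ) (m : ℕ) (Q : KRPartition G X) (m' : ℕ)
    (Q' : KRPartition G X) : Prop where
  lt : m < m'
  base_subset : Q'.base ⊆ Q.base
  refines : Q'.Refines Q
  exists_tiles : ∃ E : Set G, (∀ e ∈ E, e ∈ Q.Γ) ∧ (Q'.D : Set G) = (Q.D : Set G) * E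
  boundary_le : ∀ g : G,
    (Set.ncard ((g • (Q'.D : Set G)) ∆ (Q'.D : Set G)) : ℝ) / (Q'.D.card : ℝ) ≤
      (Set.ncard ((g • (P.D m' : Set G)) ∆ (P.D m' : Set G)) : ℝ) / ((P.D m').card : ℝ) + ε

theorem exists_tiledStep [Nonempty X] [CompactSpace X] [ContinuousConstSMul G X]
    (P : KRSequence G X) (hP : IsFolnerSequence P.D) {ε : ℝ} (hε : 0 < ε) {m : ℕ}
    {Q : KRPartition G X} (hQ : P.Adapted m Q) :
    ∃ m' Q', P.Adapted m' Q' ∧ P.TiledStep ε m Q m' Q' := by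
  classical
  -- The threshold `ε / 4` absorbs the factor `4` in front of the defect.
  have hev := (tendsto_card_tileDefect_div hP Q.D).eventually (gt_mem_nhds (div_pos hε four_pos))
  obtain ⟨m', hm', hdef⟩ := ((eventually_gt_atTop m).and hev).exists
  have hb : (P.level m').base ⊆ Q.base :=
    hQ.base_eq ▸ P.level_base_antitone hm'.le
  obtain ⟨E, hEΓ, htr, hone, hE⟩ := exists_tiled_transversal
    (KRPartition.Γ_le_of_base_subset hb) Q.transversal hQ.one_mem (P.level m').transversal
  obtain ⟨Q', hQD, hQΓ, hQb, hQr, hQQ⟩ := (P.level m').exists_refinement Q htr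
  refine ⟨m', Q', ⟨hQb, hQD ▸ hone, hQr⟩, hm', hQb ▸ hb, hQQ,
    ⟨E, hEΓ, by rw [hQD, Finset.coe_mul]⟩, fun g => ?_⟩
  have hcard : Q'.D.card = (P.D m').card := by
    rw [hQD]
    exact IsLeftTransversal.card_eq htr (P.level m').transversal
  have hle : (Set.ncard ((g • (Q'.D : Set G)) ∆ (Q'.D : Set G)) : ℝ) ≤
      Set.ncard ((g • (P.D m' : Set G)) ∆ (P.D m' : Set G)) +
        4 * (tileDefect Q.D (P.D m')).card := by
    rw [hQD]
    exact_mod_cast hE g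
  rw [hcard]
  refine (div_le_div_of_nonneg_right hle (Nat.cast_nonneg _)).trans ?_
  rw [add_div, mul_div_assoc]
  linarith

/-- Uniform incidence for a partition indexed by a union of translates `D e` with `e` in the group
of return times of the coarser partition. -/
theorem ncard_subset_eq_of_tiles {Q Q' : KRPartition G X} {E : Set G}
    (hb : Q'.base ⊆ Q.base) (hEΓ : ∀ e ∈ E, e ∈ Q.Γ) (hE : (Q'.D : Set G) = (Q.D : Set G) * E)
    {u : G} (hu : u ∈ Q.D) (i : Fin Q.k) (j : Fin Q'.k) :
    Set.ncard {w : G | w ∈ Q'.D ∧ w • Q'.C j ⊆ u • Q.C i} =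
      Set.ncard {e : G | e ∈ E ∧ e • Q'.C j ⊆ Q.C i} := by
  rw [← Set.ncard_image_of_injective {e : G | e ∈ E ∧ e • Q'.C j ⊆ Q.C i} (mul_right_injective u)]
  congr 1
  ext w
  simp only [Set.mem_ofPred_eq, Set.mem_image]
  constructor
  · rintro ⟨hw, hsub⟩
    rw [← Finset.mem_coe, hE] at hw
    obtain ⟨v, hv, e, he, rfl⟩ := hw
    have hvu : v = u := by
      refine KRPartition.eq_of_mk_eq hv hu ?_
      obtain ⟨y, hy⟩ := Q'.nonempty j
      have h1 : (v * e) • y ∈ v • Q.base := by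
        rw [← smul_smul]
        exact Set.smul_mem_smul_set ((KRPartition.smul_mem_base_iff
          (hb (Q'.C_subset_base j hy))).2 (hEΓ e he))
      exact KRPartition.mk_eq_of_mem h1
        (Set.smul_set_mono (Q.C_subset_base i) (hsub (Set.smul_mem_smul_set hy)))
    subst hvu
    refine ⟨e, ⟨he, ?_⟩, rfl⟩
    simp only [mul_smul] at hsub
    exact Set.smul_set_subset_smul_set_iff.1 hsub
  · rintro ⟨e, ⟨he, hsub⟩, rfl⟩
    refine ⟨?_, ?_⟩
    · rw [← Finset.mem_coe, hE]
      exact Set.mul_mem_mul hu he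
    · rw [mul_smul]
      exact Set.smul_set_mono hsub

theorem exists_uniformIncidence [Nonempty X] [CompactSpace X] [ContinuousConstSMul G X]
    (P : KRSequence G X) (hP : IsFolnerSequence P.D) :
    ∃ P' : KRSequence G X, IsFolnerSequence P'.D ∧ P'.HasUniformIncidence := by
  obtain ⟨Q₀, hQ₀⟩ := P.exists_adapted 0
  let S := {s : ℕ × KRPartition G X // P.Adapted s.1 s.2}
  have hstep : ∀ (n : ℕ) (s : S), ∃ s' : S,
      P.TiledStep (1 / ((n : ℝ) + 1)) s.1.1 s.1.2 s'.1.1 s'.1.2 := fun n s => by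
    obtain ⟨m', Q', h, h'⟩ := P.exists_tiledStep hP (Nat.one_div_pos_of_nat (n := n)) s.2
    exact ⟨⟨(m', Q'), h⟩, h'⟩
  choose next hnext using hstep
  let s : ℕ → S := fun n => Nat.rec ⟨(0, Q₀), hQ₀⟩ next n
  have hs : ∀ n : ℕ, P.TiledStep (1 / ((n : ℝ) + 1)) (s n).1.1 (s n).1.2 (s (n + 1)).1.1
    (s (n + 1)).1.2 := fun n => hnext n (s n)
  have hmono : StrictMono fun n => (s n).1.1 := strictMono_nat_of_lt_succ fun n => (hs n).lt
  refine ⟨ofLevels (fun n => (s n).1.2) (fun n => (hs n).base_subset) (fun n => (hs n).refines) P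
    fun m => ⟨m, (s m).2.refines.trans (P.level_refines (hmono.id_le m))⟩, ⟨?_, ?_⟩, ?_⟩
  · exact fun n => ⟨1, (s n).2.one_mem⟩
  · intro g
    -- The boundary estimate concerns the target of each step, hence says nothing about index `0`.
    rw [← tendsto_add_atTop_iff_nat 1]
    have h1 := ((hP.2 g).comp (hmono.tendsto_atTop.comp (tendsto_add_atTop_nat 1))).add
      (tendsto_one_div_add_atTop_nhds_zero_nat (𝕜 := ℝ))
    rw [add_zero] at h1
    exact squeeze_zero (fun n => by positivity) (fun n => (hs n).boundary_le g) h1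
  · intro n u hu i j
    obtain ⟨E, hEΓ, hE⟩ := (hs n).exists_tiles
    -- The incidence matrix is the count at `1`, which is a level here, so comparing `u` with `1`
    -- suffices.
    have key := fun {v : G} (hv : v ∈ (s n).1.2.D) =>
      ncard_subset_eq_of_tiles (hs n).base_subset hEΓ hE hv i j
    have h1 := key (s n).2.one_mem
    rw [one_smul] at h1
    exact (key hu).trans h1.symm

end KRSequence

/-! ### Measures on a single partition. -/

namespace KRPartition

variable {G X : Type*} [Group G] [TopologicalSpace X] [MulAction G X]

open scoped Classical in
/-- The indices of the members of `Q` which are contained in `A`. -/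
noncomputable def inside (Q : KRPartition G X) (A : Set X) : Finset (G × Fin Q.k) :=
  {p ∈ Q.idx | Q.cell p ⊆ A}

theorem mem_inside {Q : KRPartition G X} {A : Set X} {p : G × Fin Q.k} :
    p ∈ Q.inside A ↔ p ∈ Q.idx ∧ Q.cell p ⊆ A := by
  simp [inside]

theorem inside_subset (Q : KRPartition G X) (A : Set X) : Q.inside A ⊆ Q.idx :=
  fun _ hp => (mem_inside.1 hp).1

theorem biUnion_inside {Q' Q : KRPartition G X} (h : Q'.Refines Q) {q : G × Fin Q.k}
    (hq : q ∈ Q.idx) : ⋃ p ∈ Q'.inside (Q.cell q), Q'.cell p = Q.cell q := by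
  refine (Set.iUnion₂_subset fun p hp => (mem_inside.1 hp).2).antisymm fun x hx => ?_
  obtain ⟨r, hr, hsub⟩ := h _ (Q'.addr_mem_idx x)
  have hrq : r = q := eq_of_mem_cell hr hq (hsub (Q'.mem_cell_addr x)) hx
  exact Set.mem_iUnion₂.2
    ⟨_, mem_inside.2 ⟨Q'.addr_mem_idx x, hrq ▸ hsub⟩, Q'.mem_cell_addr x⟩

theorem biUnion_idx (Q : KRPartition G X) : ⋃ p ∈ Q.idx, Q.cell p = Set.univ :=
  Set.eq_univ_of_forall fun x => Set.mem_iUnion₂.2 ⟨_, Q.addr_mem_idx x, Q.mem_cell_addr x⟩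

theorem pairwiseDisjoint_cell (Q : KRPartition G X) :
    (Q.idx : Set (G × Fin Q.k)).PairwiseDisjoint Q.cell := fun p hp q hq hpq =>
  Q.disjoint p.1 (mem_idx.1 hp) q.1 (mem_idx.1 hq) p.2 q.2 hpq

theorem sum_idx {Q : KRPartition G X} {M : Type*} [AddCommMonoid M] (f : G × Fin Q.k → M) :
    ∑ p ∈ Q.idx, f p = ∑ w ∈ Q.D, ∑ i, f (w, i) := by
  rw [idx, Finset.sum_product]

/-- The combination of Dirac masses which gives the weight `y p.2` to the member `p` of `Q`. -/
noncomputable def atomic [MeasurableSpace X] (Q : KRPartition G X) (y : Fin Q.k → ℝ) : Measure X :=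
  ∑ p ∈ Q.idx, ENNReal.ofReal (y p.2) • Measure.dirac (Q.cell_nonempty p).some

theorem isProbabilityMeasure_atomic [MeasurableSpace X] (Q : KRPartition G X)
    {y : Fin Q.k → ℝ} (hy : ∀ i, 0 ≤ y i) (h1 : (Q.D.card : ℝ) * ∑ i, y i = 1) : IsProbabilityMeasure (Q.atomic y) := by
  constructor
  simp only [atomic, Measure.coe_finsetSum, Finset.sum_apply, Measure.smul_apply, measure_univ,
    smul_eq_mul, mul_one]
  rw [← ENNReal.ofReal_sum_of_nonneg fun p _ => hy p.2, idx, Finset.sum_product]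
  simp [h1]

variable [ContinuousConstSMul G X] [MeasurableSpace X] [BorelSpace X]

theorem measurableSet_cell (Q : KRPartition G X) (p : G × Fin Q.k) : MeasurableSet (Q.cell p) :=
  (Q.isClopen_cell p).2.measurableSet

theorem measureReal_smul_biUnion (Q : KRPartition G X) (μ : Measure X) [IsFiniteMeasure μ] (g : G)
    {s : Finset (G × Fin Q.k)} (hs : s ⊆ Q.idx) :
    μ.real (g • ⋃ p ∈ s, Q.cell p) = ∑ p ∈ s, μ.real (g • Q.cell p) := by
  rw [Set.smul_set_iUnion₂]
  refine measureReal_biUnion_finset (fun p hp q hq hpq => ?_) fun p _ => ?_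
  · exact (Set.disjoint_smul_set.2 (Q.pairwiseDisjoint_cell (hs hp) (hs hq) hpq))
  · exact ((Q.isClopen_cell p).2.smul g).measurableSet

/-- The translate by `g` is kept because this serves to prove invariance, where it cannot yet be
removed. -/
theorem measureReal_smul_cell {Q' Q : KRPartition G X} (h : Q'.Refines Q) (μ : Measure X)
    [IsFiniteMeasure μ] (g : G) {q : G × Fin Q.k} (hq : q ∈ Q.idx) :
    μ.real (g • Q.cell q) = ∑ p ∈ Q'.inside (Q.cell q), μ.real (g • Q'.cell p) := by
  rw [← Q'.measureReal_smul_biUnion μ g (Q'.inside_subset _), biUnion_inside h hq]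

theorem measureReal_cell {Q' Q : KRPartition G X} (h : Q'.Refines Q) (μ : Measure X)
    [IsFiniteMeasure μ] {q : G × Fin Q.k} (hq : q ∈ Q.idx) :
    μ.real (Q.cell q) = ∑ p ∈ Q'.inside (Q.cell q), μ.real (Q'.cell p) := by
  simpa using measureReal_smul_cell h μ 1 hq

theorem measureReal_smul_base (Q : KRPartition G X) (μ : Measure X) [IsFiniteMeasure μ] (g : G) :
    μ.real (g • Q.base) = ∑ i, μ.real (g • Q.C i) := by
  rw [base, Set.smul_set_iUnion]
  have hdis : Pairwise (Function.onFun Disjoint fun i => g • Q.C i) := by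
    intro i j hij
    refine Set.disjoint_smul_set.2 ?_
    obtain ⟨w, hw, -⟩ := Q.exists_mk_eq 1
    exact Set.disjoint_smul_set.1 (Q.disjoint w hw w hw i j fun h => hij (Prod.ext_iff.1 h).2)
  rw [measureReal_iUnion_fintype hdis fun i => ((Q.isClopen i).2.smul g).measurableSet]

theorem sum_measureReal_cell (Q : KRPartition G X) (μ : Measure X) [IsProbabilityMeasure μ] :
    ∑ p ∈ Q.idx, μ.real (Q.cell p) = 1 := by
  have := Q.measureReal_smul_biUnion μ 1 subset_rfl
  simp only [one_smul, biUnion_idx, probReal_univ] at this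
  exact this.symm

/-- If the `μ`-measure of the levels of a tower depends only on the tower, then the measure of the
base and of all its translates is `1 / |D|`. -/
theorem measureReal_smul_base_eq (Q : KRPartition G X) (μ : Measure X)
    [IsProbabilityMeasure μ] {y : Fin Q.k → ℝ} (hy : ∀ p ∈ Q.idx, μ.real (Q.cell p) = y p.2)
    (g : G) : μ.real (g • Q.base) = ∑ i, y i ∧ (Q.D.card : ℝ) * ∑ i, y i = 1 := by
  constructor
  · obtain ⟨w, hw, h⟩ := Q.exists_mk_eq g
    rw [← smul_base_eq h, measureReal_smul_base]
    exact Finset.sum_congr rfl fun i _ => hy (w, i) (mem_idx.2 hw)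
  · rw [← Q.sum_measureReal_cell μ, Finset.sum_congr rfl hy, sum_idx]
    simp

/-- Translating by `g` changes the measure of a union of members of `Q` by at most twice the
proportion of levels which `g` moves out of the towers. -/
theorem abs_measureReal_smul_sub_le [DecidableEq G] (Q : KRPartition G X) (μ : Measure X)
    [IsProbabilityMeasure μ] {y : Fin Q.k → ℝ} (hy : ∀ p ∈ Q.idx, μ.real (Q.cell p) = y p.2)
    (g : G) {s : Finset (G × Fin Q.k)} (hs : s ⊆ Q.idx) :
    |∑ p ∈ s, μ.real (g • Q.cell p) - ∑ p ∈ s, μ.real (Q.cell p)| ≤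
      2 * ((Set.ncard ((g • (Q.D : Set G)) ∆ (Q.D : Set G)) : ℝ) / (Q.D.card : ℝ)) := by
  have hc := (Q.measureReal_smul_base_eq μ hy 1).2
  have hc' : ∑ i, y i = 1 / (Q.D.card : ℝ) := by
    have : (Q.D.card : ℝ) ≠ 0 := by
      rintro h
      simp [h] at hc
    field_simp
    linarith
  have hinner : ∀ w ∈ Q.D, ∑ i, |μ.real (g • Q.cell (w, i)) - μ.real (Q.cell (w, i))| ≤
      if g * w ∉ Q.D then 2 / (Q.D.card : ℝ) else 0 := by
    intro w hw
    by_cases hgw : g * w ∉ Q.D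
    · rw [if_pos hgw]
      -- For a level moved out of the towers only the trivial bound is used: both translates of the
      -- base have mass `1 / |D|`.
      refine (Finset.sum_le_sum fun i _ => (abs_sub _ _).trans_eq (by
        rw [abs_of_nonneg measureReal_nonneg, abs_of_nonneg measureReal_nonneg])).trans ?_
      rw [Finset.sum_add_distrib]
      have h1 := measureReal_smul_base Q μ (g * w)
      have h2 := measureReal_smul_base Q μ w
      rw [(Q.measureReal_smul_base_eq μ hy _).1, hc'] at h1 h2
      simp only [cell, smul_smul]
      rw [← h1, ← h2]
      exact le_of_eq (by ring)
    · rw [if_neg hgw]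
      refine le_of_eq (Finset.sum_eq_zero fun i _ => ?_)
      rw [not_not] at hgw
      have : g • Q.cell (w, i) = Q.cell (g * w, i) := smul_smul _ _ _
      rw [this, hy (g * w, i) (mem_idx.2 hgw), hy (w, i) (mem_idx.2 hw)]
      simp
  calc |∑ p ∈ s, μ.real (g • Q.cell p) - ∑ p ∈ s, μ.real (Q.cell p)|
      ≤ ∑ p ∈ s, |μ.real (g • Q.cell p) - μ.real (Q.cell p)| := by
        rw [← Finset.sum_sub_distrib]
        exact Finset.abs_sum_le_sum_abs _ _
    _ ≤ ∑ p ∈ Q.idx, |μ.real (g • Q.cell p) - μ.real (Q.cell p)| :=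
        Finset.sum_le_sum_of_subset_of_nonneg hs fun _ _ _ => abs_nonneg _
    _ ≤ ∑ w ∈ Q.D, if g * w ∉ Q.D then 2 / (Q.D.card : ℝ) else 0 := by
        rw [sum_idx]
        exact Finset.sum_le_sum hinner
    _ = (Q.D.filter fun w => g * w ∉ Q.D).card * (2 / (Q.D.card : ℝ)) := by
        rw [← Finset.sum_filter, Finset.sum_const, nsmul_eq_mul]
    _ ≤ Set.ncard ((g • (Q.D : Set G)) ∆ (Q.D : Set G)) * (2 / (Q.D.card : ℝ)) := by
        gcongr
        exact card_filter_mul_notMem_le Q.D g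
    _ = _ := by ring

theorem atomic_cell (Q : KRPartition G X) {y : Fin Q.k → ℝ} (hy : ∀ i, 0 ≤ y i)
    {q : G × Fin Q.k} (hq : q ∈ Q.idx) : (Q.atomic y).real (Q.cell q) = y q.2 := by
  rw [Measure.real, atomic]
  simp only [Measure.coe_finsetSum, Finset.sum_apply, Measure.smul_apply, smul_eq_mul]
  rw [Finset.sum_eq_single_of_mem q hq]
  · rw [Measure.dirac_apply' _ (Q.measurableSet_cell q),
      Set.indicator_of_mem (Q.cell_nonempty q).some_mem]
    simp [hy]
  · intro p hp hpq
    rw [Measure.dirac_apply' _ (Q.measurableSet_cell q), Set.indicator_of_notMem, mul_zero]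
    exact fun h => hpq (eq_of_mem_cell hp hq (Q.cell_nonempty p).some_mem h)

end KRPartition

theorem invariantMix_real {G X : Type*} [Group G] [MeasurableSpace X] [MulAction G X]
    (t : Set.Icc (0 : ℝ) 1) (μ ν : invariantMeasures G X) (A : Set X) :
    ((invariantMix t μ ν : ProbabilityMeasure X) : Measure X).real A =
      t * ((μ : ProbabilityMeasure X) : Measure X).real A +
        (1 - t) * ((ν : ProbabilityMeasure X) : Measure X).real A := by
  have : ((invariantMix t μ ν : ProbabilityMeasure X) : Measure X) =
      ENNReal.ofReal (t : ℝ) • ((μ : ProbabilityMeasure X) : Measure X) +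
      ENNReal.ofReal (1 - (t : ℝ)) • ((ν : ProbabilityMeasure X) : Measure X) := rfl
  rw [this, measureReal_add_apply (ENNReal.mul_ne_top ENNReal.ofReal_ne_top (measure_ne_top _ _))
      (ENNReal.mul_ne_top ENNReal.ofReal_ne_top (measure_ne_top _ _)),
    measureReal_ennreal_smul_apply, measureReal_ennreal_smul_apply,
    ENNReal.toReal_ofReal t.2.1, ENNReal.toReal_ofReal (sub_nonneg.2 t.2.2)]

/-! ### Invariant measures and the inverse limit. -/

namespace KRSequence

variable {G X : Type*} [Group G] [TopologicalSpace X] [MulAction G X]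

open KRPartition

/-- The members of all partitions of a Kakutani–Rohlin sequence. -/
def cells (P : KRSequence G X) : Set (Set X) :=
  {s | ∃ n, ∃ p ∈ (P.level n).idx, s = (P.level n).cell p}

theorem isTopologicalBasis_cells (P : KRSequence G X) :
    TopologicalSpace.IsTopologicalBasis P.cells := by
  convert! P.spans using 1
  ext s
  constructor
  · rintro ⟨n, p, hp, rfl⟩
    exact ⟨n, p.1, mem_idx.1 hp, p.2, rfl⟩
  · rintro ⟨n, w, hw, i, rfl⟩
    exact ⟨n, (w, i), mem_idx.2 hw, rfl⟩

/-- Two cells that meet are nested, since the later partition refines the earlier one. -/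
theorem isPiSystem_cells (P : KRSequence G X) : IsPiSystem P.cells := by
  have key : ∀ {m n : ℕ}, m ≤ n → ∀ p ∈ (P.level m).idx, ∀ q ∈ (P.level n).idx,
      ((P.level m).cell p ∩ (P.level n).cell q).Nonempty →
      (P.level n).cell q ⊆ (P.level m).cell p := by
    rintro m n h p hp q hq ⟨x, hxp, hxq⟩
    obtain ⟨r, hr, hqr⟩ := P.level_refines h q hq
    rwa [eq_of_mem_cell hp hr hxp (hqr hxq)]
  rintro _ ⟨m, p, hp, rfl⟩ _ ⟨n, q, hq, rfl⟩ hne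
  rcases le_total m n with h | h
  · rw [Set.inter_eq_right.2 (key h p hp q hq hne)]
    exact ⟨n, q, hq, rfl⟩
  · rw [Set.inter_eq_left.2 (key h q hq p hp (Set.inter_comm _ _ ▸ hne))]
    exact ⟨m, p, hp, rfl⟩

/-- Uniform incidence, summed against a vector indexed by the towers. -/
theorem sum_inside_eq_mulVec (P : KRSequence G X) (hU : P.HasUniformIncidence) (n : ℕ)
    (y : Fin (P.k (n + 1)) → ℝ) {q : G × Fin (P.k n)} (hq : q ∈ (P.level n).idx) :
    ∑ p ∈ (P.level (n + 1)).inside ((P.level n).cell q), y p.2 =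
      ((P.incidence n).map (fun a : ℕ => (a : ℝ))).mulVec y q.2 := by
  classical
  have hset : ∀ j, {w : G | w ∈ P.D (n + 1) ∧ w • P.C (n + 1) j ⊆ q.1 • P.C n q.2} =
      ((P.D (n + 1)).filter fun w => w • P.C (n + 1) j ⊆ q.1 • P.C n q.2 : Finset G) := by
    intro j
    ext w
    simp
  have hsum : ∑ p ∈ (P.level (n + 1)).inside ((P.level n).cell q), y p.2 =
      ∑ j, ∑ w ∈ P.D (n + 1), if w • P.C (n + 1) j ⊆ q.1 • P.C n q.2 then y j else 0 := by
    rw [Finset.sum_comm]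
    simp only [inside, Finset.sum_filter]
    exact Finset.sum_product _ _ _
  rw [hsum, Matrix.mulVec_eq_sum, Finset.sum_apply]
  refine Finset.sum_congr rfl fun j _ => ?_
  rw [← Finset.sum_filter, Finset.sum_const, nsmul_eq_mul]
  simp only [Pi.smul_apply, Matrix.transpose_apply, Matrix.map_apply, op_smul_eq_mul]
  rw [← hU n q.1 (mem_idx.1 hq) q.2 j, hset j, Set.ncard_coe_finset]

variable [MeasurableSpace X] [BorelSpace X]

theorem measure_ext_of_cells [SecondCountableTopology X] (P : KRSequence G X) {μ ν : Measure X}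
    [IsProbabilityMeasure μ] [IsProbabilityMeasure ν]
    (h : ∀ n, ∀ p ∈ (P.level n).idx,
      μ.real ((P.level n).cell p) = ν.real ((P.level n).cell p)) : μ = ν := by
  refine ext_of_generate_finite P.cells
    (BorelSpace.measurable_eq.trans P.isTopologicalBasis_cells.borel_eq_generateFrom)
    P.isPiSystem_cells ?_ (by simp)
  rintro _ ⟨n, p, hp, rfl⟩
  exact (measureReal_eq_measureReal_iff).1 (h n p hp)

theorem measureReal_cell_of_invariant (P : KRSequence G X) (μ : invariantMeasures G X) (n : ℕ)
    (p : G × Fin (P.k n)) : ((μ : ProbabilityMeasure X) : Measure X).real ((P.level n).cell p) =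
      ((μ : ProbabilityMeasure X) : Measure X).real (P.C n p.2) :=
  congrArg ENNReal.toReal (μ.2 p.1 (P.C n p.2) (P.isClopen n p.2).2.measurableSet)

variable [ContinuousConstSMul G X]

/-- A probability measure for which the levels of each tower of a Følner Kakutani–Rohlin sequence
have the same measure is invariant. -/
theorem mem_invariantMeasures_of_cells [SecondCountableTopology X] (P : KRSequence G X)
    (hP : IsFolnerSequence P.D) {μ : ProbabilityMeasure X} {y : (n : ℕ) → Fin (P.k n) → ℝ}
    (hy : ∀ n, ∀ p ∈ (P.level n).idx, (μ : Measure X).real ((P.level n).cell p) = y n p.2) :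
    μ ∈ invariantMeasures G X := by
  classical
  intro g B hB
  have hcell : ∀ m, ∀ q ∈ (P.level m).idx, (μ : Measure X).real (g • (P.level m).cell q) =
      (μ : Measure X).real ((P.level m).cell q) := by
    intro m q hq
    have hlim := (hP.2 g).const_mul 2
    rw [mul_zero] at hlim
    -- The difference does not depend on `n`, while decomposing the cell at level `n` bounds it by a
    -- null sequence.
    refine sub_eq_zero.1 (abs_nonpos_iff.1 (ge_of_tendsto hlim ?_))
    filter_upwards [eventually_ge_atTop m] with n hn
    rw [measureReal_smul_cell (P.level_refines hn) _ g hq,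
      measureReal_cell (P.level_refines hn) _ hq]
    exact (P.level n).abs_measureReal_smul_sub_le μ (hy n) g ((P.level n).inside_subset _)
  have hmeas : Measurable fun x : X => g⁻¹ • x := (continuous_const_smul g⁻¹).measurable
  have hmap : ∀ {S : Set X}, MeasurableSet S →
      (μ : Measure X).map (fun x => g⁻¹ • x) S = (μ : Measure X) (g • S) := by
    intro S hS
    rw [Measure.map_apply hmeas hS, ← Set.preimage_smul_inv]
  have : IsProbabilityMeasure ((μ : Measure X).map fun x => g⁻¹ • x) :=
    Measure.isProbabilityMeasure_map hmeas.aemeasurable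
  have heq : (μ : Measure X).map (fun x => g⁻¹ • x) = μ := by
    refine P.measure_ext_of_cells fun n p hp => ?_
    rw [Measure.real, hmap ((P.level n).measurableSet_cell p)]
    exact hcell n p hp
  rw [← hmap hB, heq]

theorem measureReal_mem_inverseLimit [Nonempty X] (P : KRSequence G X) (hU : P.HasUniformIncidence)
    (μ : invariantMeasures G X) :
    (fun n i => ((μ : ProbabilityMeasure X) : Measure X).real (P.C n i)) ∈ P.inverseLimit := by
  refine ⟨fun n => ⟨fun i => measureReal_nonneg, ?_⟩, fun n => funext fun i => ?_⟩
  · have h := ((P.level n).measureReal_smul_base_eq ((μ : ProbabilityMeasure X) : Measure X)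
      (y := fun i => ((μ : ProbabilityMeasure X) : Measure X).real (P.C n i))
      (fun p _ => P.measureReal_cell_of_invariant μ n p) 1).2
    exact eq_one_div_of_mul_eq_one_right h
  · obtain ⟨u, hu, -⟩ := (P.level n).exists_mk_eq 1
    have hq : ((u, i) : G × Fin (P.k n)) ∈ (P.level n).idx := mem_idx.2 hu
    rw [← P.sum_inside_eq_mulVec hU n _ hq]
    refine Eq.trans ?_ (P.measureReal_cell_of_invariant μ n (u, i))
    rw [measureReal_cell (P.level_refines n.le_succ) _ hq]
    exact Finset.sum_congr rfl fun p _ => (P.measureReal_cell_of_invariant μ (n + 1) p).symm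

/-- Every point of the inverse limit gives the values of a probability measure on the members of
all partitions. -/
theorem exists_measure_of_mem_inverseLimit [T2Space X] [SecondCountableTopology X]
    [HasOuterApproxClosed X] [CompactSpace X] (P : KRSequence G X)
    (hP : IsFolnerSequence P.D) (hU : P.HasUniformIncidence)
    {y : (n : ℕ) → Fin (P.k n) → ℝ} (hy : y ∈ P.inverseLimit) :
    ∃ μ : ProbabilityMeasure X, ∀ n, ∀ p ∈ (P.level n).idx,
      (μ : Measure X).real ((P.level n).cell p) = y n p.2 := by
  have hpos : ∀ n, ∀ i : Fin (P.level n).k, 0 ≤ y n i := fun n i => (hy.1 n).1 i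
  have hprob : ∀ n, IsProbabilityMeasure ((P.level n).atomic (y n)) := fun n => by
    refine (P.level n).isProbabilityMeasure_atomic (hpos n) ?_
    have h0 : ((P.D n).card : ℝ) ≠ 0 := Nat.cast_ne_zero.2 (hP.1 n).card_ne_zero
    have h := (hy.1 n).2
    rw [eq_div_iff h0, mul_comm] at h
    exact h
  have hval : ∀ m n, m ≤ n → ∀ q ∈ (P.level m).idx,
      ((P.level n).atomic (y n)).real ((P.level m).cell q) = y m q.2 := by
    intro m n hmn
    induction n, hmn using Nat.le_induction with
    | base => exact fun q hq => (P.level m).atomic_cell (hpos m) hq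
    | succ n hmn ih =>
      intro q hq
      rw [← ih q hq, measureReal_cell (P.level_refines hmn) _ hq,
        measureReal_cell (P.level_refines hmn) _ hq]
      refine Finset.sum_congr rfl fun p hp => ?_
      have hp := (P.level n).inside_subset _ hp
      rw [(P.level n).atomic_cell (hpos n) hp, measureReal_cell (P.level_refines n.le_succ) _ hp,
        ← congrFun (hy.2 n) p.2, ← P.sum_inside_eq_mulVec hU n (y (n + 1)) hp]
      exact Finset.sum_congr rfl fun r hr => (P.level (n + 1)).atomic_cell (hpos (n + 1))
        ((P.level (n + 1)).inside_subset _ hr)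
  let ν : ℕ → ProbabilityMeasure X := fun n => ⟨(P.level n).atomic (y n), hprob n⟩
  -- Compactness of the space of probability measures gives a limit along an ultrafilter; on clopen
  -- sets the mass passes to the limit, and on each cell it is eventually constant.
  obtain ⟨μ, -, hμ⟩ := isCompact_univ.ultrafilter_le_nhds' (Ultrafilter.map ν (hyperfilter ℕ))
    univ_mem
  have hμ' : Tendsto ν (hyperfilter ℕ : Filter ℕ) (𝓝 μ) := hμ
  refine ⟨μ, fun m q hq => ?_⟩
  have hlim : Tendsto (fun n => (ν n : Measure X).real ((P.level m).cell q))
      (hyperfilter ℕ : Filter ℕ) (𝓝 ((μ : Measure X).real ((P.level m).cell q))) := by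
    have := ProbabilityMeasure.tendsto_measure_of_isClopen_of_tendsto hμ'
      ((P.level m).isClopen_cell q)
    simpa using (NNReal.tendsto_coe.2 this)
  refine tendsto_nhds_unique hlim (tendsto_const_nhds.congr' ?_)
  filter_upwards [Nat.hyperfilter_le_atTop (eventually_ge_atTop m)] with n hn
  exact (hval m n hn q hq).symm

theorem isAffineHomeomorphicToInverseLimit [Nonempty X] [CompactSpace X]
    [TopologicalSpace.MetrizableSpace X] (P : KRSequence G X) (hP : IsFolnerSequence P.D)
    (hU : P.HasUniformIncidence) : P.IsAffineHomeomorphicToInverseLimit := by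
  let _ := TopologicalSpace.metrizableSpaceMetric X
  let Φ : invariantMeasures G X → P.inverseLimit := fun μ =>
    ⟨_, P.measureReal_mem_inverseLimit hU μ⟩
  have hΦ : ∀ (μ : invariantMeasures G X) (n : ℕ) (i : Fin (P.k n)),
      (Φ μ : (n : ℕ) → Fin (P.k n) → ℝ) n i =
        ((μ : ProbabilityMeasure X) : Measure X).real (P.C n i) := fun _ _ _ => rfl
  have hcell : ∀ (μ : invariantMeasures G X) (n : ℕ) (p : G × Fin (P.k n)),
      ((μ : ProbabilityMeasure X) : Measure X).real ((P.level n).cell p) =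
        (Φ μ : (n : ℕ) → Fin (P.k n) → ℝ) n p.2 := P.measureReal_cell_of_invariant
  have hinj : Function.Injective Φ := by
    intro μ ν h
    refine Subtype.ext (ProbabilityMeasure.toMeasure_injective (P.measure_ext_of_cells ?_))
    intro n p _
    exact (hcell μ n p).trans (h ▸ (hcell ν n p).symm)
  have hsurj : Function.Surjective Φ := by
    intro y
    obtain ⟨μ, hμ⟩ := P.exists_measure_of_mem_inverseLimit hP hU y.2
    refine ⟨⟨μ, P.mem_invariantMeasures_of_cells hP hμ⟩, Subtype.ext ?_⟩
    funext n i
    obtain ⟨u, hu, -⟩ := (P.level n).exists_mk_eq 1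
    rw [← hμ n (u, i) (mem_idx.2 hu)]
    exact (hcell ⟨μ, P.mem_invariantMeasures_of_cells hP hμ⟩ n (u, i)).symm
  let e : invariantMeasures G X ≃ P.inverseLimit := Equiv.ofBijective Φ ⟨hinj, hsurj⟩
  have hcont : Continuous Φ := by
    refine Continuous.subtype_mk (continuous_pi fun n => continuous_pi fun i => ?_) _
    rw [continuous_iff_continuousAt]
    intro μ
    have := ProbabilityMeasure.tendsto_measure_of_isClopen_of_tendsto
      (continuous_subtype_val.tendsto μ) (P.isClopen n i)
    simpa [ContinuousAt] using (NNReal.tendsto_coe.2 this)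
  have hinv : Continuous e.symm := by
    rw [continuous_iff_continuousAt]
    intro y
    -- Convergence on a π-system containing arbitrarily small neighbourhoods of each point implies
    -- weak convergence; on cells it is convergence of coordinates.
    refine tendsto_subtype_rng.2 (P.isPiSystem_cells.tendsto_probabilityMeasure_of_tendsto_of_mem
      ?_ ?_ ?_)
    · rintro _ ⟨n, p, -, rfl⟩
      exact (P.level n).measurableSet_cell p
    · intro U hU x hx
      obtain ⟨A, hA, hxA, hAU⟩ := P.isTopologicalBasis_cells.exists_subset_of_mem_open hx hU
      exact ⟨A, hA, (P.isTopologicalBasis_cells.isOpen hA).mem_nhds hxA, hAU⟩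
    · rintro _ ⟨n, p, -, rfl⟩
      rw [← NNReal.tendsto_coe]
      have h : ∀ z : P.inverseLimit,
          (((e.symm z : ProbabilityMeasure X) ((P.level n).cell p) : NNReal) : ℝ) =
            (z : (n : ℕ) → Fin (P.k n) → ℝ) n p.2 := by
        intro z
        rw [← ProbabilityMeasure.measureReal_eq_coe_coeFn]
        refine (hcell (e.symm z) n p).trans ?_
        exact congrFun (congrFun (congrArg Subtype.val (e.apply_symm_apply z)) n) p.2
      simp only [h]
      exact (((continuous_apply p.2).comp (continuous_apply n)).comp
        continuous_subtype_val).tendsto y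
  refine ⟨⟨e, hcont, hinv⟩, fun t μ ν => ?_, hΦ⟩
  funext n i
  exact invariantMix_real t μ ν _

end KRSequence

theorem lemma4p3 {G X : Type*} [Group G] [Group.FG G]
    [TopologicalSpace X] [CompactSpace X] [TopologicalSpace.MetrizableSpace X]
    [MeasurableSpace X] [BorelSpace X] [MulAction G X] [ContinuousConstSMul G X]
    (hG : IsAmenableGroup G) (hX : IsRegularlyRecurrentCantorSystem G X)
    (P₀ : KRSequence G X) (hP₀ : IsFolnerSequence P₀.D) :
    (∃ P : KRSequence G X, IsFolnerSequence P.D ∧ P.HasUniformIncidence) ∧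
    (∀ P : KRSequence G X, IsFolnerSequence P.D → P.HasUniformIncidence →
      P.IsAffineHomeomorphicToInverseLimit) := by
  obtain ⟨x, -⟩ := hX.2
  have : Nonempty X := ⟨x⟩
  exact ⟨P₀.exists_uniformIncidence hP₀, fun P hP hU => P.isAffineHomeomorphicToInverseLimit hP hU⟩
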